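/- Let $\mathbb N^{\mathbb N}$ be Baire space. A computational problem is a partial multi-valued function $f :\subseteq \mathbb N^{\mathbb N} \rightrightarrows \mathbb N^{\mathbb N}$, i.e. a map sending each $p$ to a set $f(p)\subseteq\mathbb N^{\mathbb N}$, with $\operatorname{dom}(f)=\{p : f(p)\neq\emptyset\}$. For problems $f,g$ write $f\le_{\mathrm W} g$ ($f$ is Weihrauch reducible to $g$) if there are computable partial functionals $\Phi:\subseteq\mathbb N^{\mathbb N}\to\mathbb N^{\mathbb N}$ and $\Psi:\subseteq\mathbb N^{\mathbb N}\times\mathbb N^{\mathbb N}\to\mathbb N^{\mathbb N}$ such that for every $p\in\operatorname{dom}(f)$, $\Phi(p)$ is defined and belongs to $\operatorname{dom}(g)$, and for every $q\in g(\Phi(p))$, $\Psi(p,q)$ is defined and belongs to $f(p)$. Let $(\mathcal W,\le_{\mathrm W})$ be the partial order of Weihrauch degrees, i.e. of problems modulo mutual Weihrauch reducibility, and let $\operatorname{id}:\mathbb N^{\mathbb N}\to\mathbb N^{\mathbb N}$ be the identity function. In a partial order, $\mathbf a$ is a strong minimal cover of $\mathbf b$ if $\mathbf b<\mathbf a$ and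 every $\mathbf c<\mathbf a$ satisfies $\mathbf c\le\mathbf b$; we say that $\mathbf a$ is a strong minimal cover if it is a strong minimal cover of some $\mathbf b$. Theorem. The Weihrauch degree of $\operatorname{id}$ is first-order definable without parameters in $(\mathcal W,\le_{\mathrm W})$: there is a first-order formula in the language with the single binary relation symbol $\le$ whose only solution in $\mathcal W$ is the degree of $\operatorname{id}$. Moreover, the degree of $\operatorname{id}$ is both: 1. the greatest element of the set of all degrees in $\mathcal W$ that are strong minimal covers, and 2. the least element of the set of all degrees $\mathbf a\in\mathcal W$ such that the cone $\{\mathbf b\in\mathcal W : \mathbf a\le_{\mathrm W}\mathbf b\}$ is dense, i.e. such that whenever $\mathbf a\le_{\mathrm W}\mathbf b<_{\mathrm W}\mathbf c$ there is a degree $\mathbf d$ with $\mathbf b<_{\mathrm W}\mathbf d<_{\mathrm W}\mathbf c$. -/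

import Mathlib

namespace Weihrauch

/-- Baire space `ℕ^ℕ`. -/
abbrev Baire : Type := ℕ → ℕ

/-- The standard pairing `⟨p, q⟩ = (p 0, q 0, p 1, q 1, …)` on Baire space, through which
functionals of two arguments are functionals of one argument. -/
def join (p q : Baire) : Baire :=
  fun n => if n % 2 = 0 then p (n / 2) else q (n / 2)

/-- Programs for partial recursive functions with an oracle: the clauses of `Nat.Partrec`
together with one instruction that queries the oracle. -/
inductive OracleCode : Type
  | zero : OracleCode
  | succ : OracleCode
  | left : OracleCode
  | right : OracleCode
  | query : OracleCode
  | pair : OracleCode → OracleCode → OracleCode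
  | comp : OracleCode → OracleCode → OracleCode
  | prec : OracleCode → OracleCode → OracleCode
  | rfind : OracleCode → OracleCode

namespace OracleCode

/-- `c.eval p` is the partial function on `ℕ` computed by the program `c` with oracle `p`. -/
def eval (p : Baire) : OracleCode → ℕ → Part ℕ
  | zero => fun _ => Part.some 0
  | succ => fun n => Part.some (n + 1)
  | left => fun n => Part.some n.unpair.1
  | right => fun n => Part.some n.unpair.2
  | query => fun n => Part.some (p n)
  | pair c d => fun n => (eval p c n).bind fun a => (eval p d n).map fun b => Nat.pair a b
  | comp c d => fun n => (eval p d n).bind (eval p c)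
  | prec c d => fun n =>
      Nat.rec (eval p c n.unpair.1)
        (fun y IH => IH.bind fun i => eval p d (Nat.pair n.unpair.1 (Nat.pair y i))) n.unpair.2
  | rfind c => fun a =>
      Nat.rfind fun n => (eval p c (Nat.pair a n)).map fun m => decide (m = 0)

/-- The partial functional `Φ_c` on Baire space computed by `c`: it maps `p` to `q` when `c` with
oracle `p` halts on every input `n` with output `q n`, and it is undefined at `p` when `c` with
oracle `p` diverges on some input. -/
def functional (c : OracleCode) : Baire → Part Baire :=
  fun p => ⟨∀ n, (c.eval p n).Dom, fun h n => (c.eval p n).get (h n)⟩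

theorem mem_functional {c : OracleCode} {p q : Baire} :
    q ∈ c.functional p ↔ ∀ n, q n ∈ c.eval p n := by
  constructor
  · rintro ⟨h, rfl⟩ n
    exact Part.get_mem (h n)
  · intro h
    refine ⟨fun n => Part.dom_iff_mem.2 ⟨_, h n⟩, ?_⟩
    funext n
    exact Part.get_eq_of_mem (h n) _

/-- `c.subst d` is the program `c` with its oracle queries replaced by runs of the program `d`. -/
def subst : OracleCode → OracleCode → OracleCode
  | zero, _ => zero
  | succ, _ => succ
  | left, _ => left
  | right, _ => right
  | query, d => d
  | pair a b, d => pair (subst a d) (subst b d)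
  | comp a b, d => comp (subst a d) (subst b d)
  | prec a b, d => prec (subst a d) (subst b d)
  | rfind a, d => rfind (subst a d)

theorem eval_subst {d : OracleCode} {p q : Baire} (h : q ∈ d.functional p) (c : OracleCode) :
    (c.subst d).eval p = c.eval q := by
  induction c with
  | zero | succ | left | right => rfl
  | query =>
    funext n
    exact Part.eq_some_iff.2 (mem_functional.1 h n)
  | pair a b iha ihb | comp a b iha ihb | prec a b iha ihb => simp only [subst, eval, iha, ihb]
  | rfind a iha => simp only [subst, eval, iha]

theorem exists_of_partrec {f : ℕ →. ℕ} (hf : Nat.Partrec f) :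
    ∃ c : OracleCode, ∀ p n, c.eval p n = f n := by
  induction hf with
  | zero => exact ⟨zero, fun _ _ => rfl⟩
  | succ => exact ⟨succ, fun _ _ => rfl⟩
  | left => exact ⟨left, fun _ _ => rfl⟩
  | right => exact ⟨right, fun _ _ => rfl⟩
  | pair _ _ ihf ihg =>
    obtain ⟨c, hc⟩ := ihf
    obtain ⟨d, hd⟩ := ihg
    refine ⟨pair c d, fun p n => ?_⟩
    simp [eval, hc, hd, Seq.seq, Part.bind_map]
  | comp _ _ ihf ihg =>
    obtain ⟨c, hc⟩ := ihf
    obtain ⟨d, hd⟩ := ihg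
    refine ⟨comp c d, fun p n => ?_⟩
    simp only [eval, hd]
    congr 1
    exact funext (hc p)
  | prec _ _ ihf ihg =>
    obtain ⟨c, hc⟩ := ihf
    obtain ⟨d, hd⟩ := ihg
    refine ⟨prec c d, fun p n => ?_⟩
    simp [eval, hc, hd, Nat.unpaired]
  | rfind _ ihf =>
    obtain ⟨c, hc⟩ := ihf
    refine ⟨rfind c, fun p n => ?_⟩
    simp [eval, hc]

theorem exists_of_computable {f : ℕ → ℕ} (hf : Computable f) :
    ∃ c : OracleCode, ∀ p n, c.eval p n = Part.some (f n) := by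
  obtain ⟨c, hc⟩ := exists_of_partrec (Partrec.nat_iff.1 hf)
  exact ⟨c, fun p n => by rw [hc]; rfl⟩

/-- A program that returns the oracle reindexed along a computable function. -/
theorem exists_reindex {f : ℕ → ℕ} (hf : Computable f) :
    ∃ c : OracleCode, ∀ p, (fun n => p (f n)) ∈ c.functional p := by
  obtain ⟨c, hc⟩ := exists_of_computable hf
  refine ⟨comp query c, fun p => mem_functional.2 fun n => ?_⟩
  simp [eval, hc]

/-- A program that computes the pairing of the outputs of two programs. -/
theorem exists_join (c d : OracleCode) :
    ∃ e : OracleCode, ∀ x p q, p ∈ c.functional x → q ∈ d.functional x →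
      join p q ∈ e.functional x := by
  have h2 : Computable fun n : ℕ => n / 2 :=
    (Primrec.nat_div.comp Primrec.id (Primrec.const 2)).to_comp
  have hs : Computable fun n : ℕ =>
      if n.unpair.1 % 2 = 0 then n.unpair.2.unpair.1 else n.unpair.2.unpair.2 := by
    have hu : Primrec fun n : ℕ => n.unpair.2.unpair :=
      Primrec.unpair.comp (Primrec.snd.comp Primrec.unpair)
    exact (Primrec.ite
      (Primrec.eq.comp (Primrec.nat_mod.comp (Primrec.fst.comp Primrec.unpair)
        (Primrec.const 2)) (Primrec.const 0))
      (Primrec.fst.comp hu) (Primrec.snd.comp hu)).to_comp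
  obtain ⟨b, hb⟩ := exists_of_computable h2
  obtain ⟨s, hs⟩ := exists_of_computable hs
  obtain ⟨i, hi⟩ := exists_of_computable Computable.id
  refine ⟨comp s (pair i (pair (comp c b) (comp d b))), fun x p q hp hq =>
    mem_functional.2 fun n => ?_⟩
  have hp' := Part.eq_some_iff.2 (mem_functional.1 hp (n / 2))
  have hq' := Part.eq_some_iff.2 (mem_functional.1 hq (n / 2))
  simp only [eval, hb, hi, Part.bind_some, hp', hq', Part.map_some, hs, join, Part.mem_some_iff]
  simp

/-- Composition of programs. -/
theorem mem_functional_subst {c d : OracleCode} {p q r : Baire} (hd : q ∈ d.functional p)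
    (hc : r ∈ c.functional q) : r ∈ (c.subst d).functional p := by
  rw [mem_functional] at hc ⊢
  rwa [eval_subst hd]

theorem exists_fst : ∃ c : OracleCode, ∀ p q, p ∈ c.functional (join p q) := by
  obtain ⟨c, hc⟩ := exists_reindex
    (Primrec.nat_mul.comp (Primrec.const 2) Primrec.id : Primrec fun n : ℕ => 2 * n).to_comp
  refine ⟨c, fun p q => ?_⟩
  have h := hc (join p q)
  simpa [join] using h

theorem exists_snd : ∃ c : OracleCode, ∀ p q, q ∈ c.functional (join p q) := by
  obtain ⟨c, hc⟩ := exists_reindex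
    (Primrec.succ.comp (Primrec.nat_mul.comp (Primrec.const 2) Primrec.id) :
      Primrec fun n : ℕ => 2 * n + 1).to_comp
  refine ⟨c, fun p q => ?_⟩
  have h := hc (join p q)
  have h1 : ∀ n : ℕ, (2 * n + 1) % 2 = 1 := by omega
  have h2 : ∀ n : ℕ, (2 * n + 1) / 2 = n := by omega
  simpa [join, h1, h2] using h

end OracleCode

/-- A partial functional on Baire space is computable if some oracle program computes it. -/
def IsComputable (Φ : Baire → Part Baire) : Prop :=
  ∃ c : OracleCode, c.functional = Φ

/-- A computational problem, that is, a partial multi-valued function on Baire space: `f.sol p` is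
the set of values at `p`, and `f` is undefined at `p` when this set is empty. -/
structure Problem : Type where
  sol : Baire → Set Baire

namespace Problem

/-- The domain of a partial multi-valued function. -/
def dom (f : Problem) : Set Baire :=
  {p | (f.sol p).Nonempty}

/-- Weihrauch reducibility `f ≤_W g`: there are computable partial functionals `Φ` and `Ψ` such
that for all `p ∈ dom f`, `Φ p` is defined and in `dom g`, and for all `q ∈ g (Φ p)`, `Ψ (p, q)` is
defined and in `f p`. -/
def Reducible (f g : Problem) : Prop :=
  ∃ Φ Ψ : Baire → Part Baire, IsComputable Φ ∧ IsComputable Ψ ∧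
    ∀ p ∈ f.dom, ∃ r ∈ Φ p, r ∈ g.dom ∧
      ∀ q ∈ g.sol r, ∃ s ∈ Ψ (join p q), s ∈ f.sol p

/-- The identity function on Baire space, as a problem. -/
def identity : Problem where
  sol p := {p}

theorem Reducible.refl (f : Problem) : f.Reducible f := by
  obtain ⟨c, hc⟩ := OracleCode.exists_snd
  refine ⟨_, _, ⟨.query, rfl⟩, ⟨c, rfl⟩, fun p hp => ⟨p, ?_, hp, fun q hq => ⟨q, hc p q, hq⟩⟩⟩
  exact OracleCode.mem_functional.2 fun n => Part.mem_some _

theorem Reducible.trans {f g h : Problem} (hfg : f.Reducible g) (hgh : g.Reducible h) :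
    f.Reducible h := by
  obtain ⟨_, _, ⟨a, rfl⟩, ⟨b, rfl⟩, h1⟩ := hfg
  obtain ⟨_, _, ⟨c, rfl⟩, ⟨d, rfl⟩, h2⟩ := hgh
  obtain ⟨l, hl⟩ := OracleCode.exists_fst
  obtain ⟨r, hr⟩ := OracleCode.exists_snd
  obtain ⟨e, he⟩ := OracleCode.exists_join (a.subst l) r
  obtain ⟨k, hk⟩ := OracleCode.exists_join l (d.subst e)
  refine ⟨_, _, ⟨c.subst a, rfl⟩, ⟨b.subst k, rfl⟩, fun p hp => ?_⟩
  obtain ⟨u, hu, hug, hu'⟩ := h1 p hp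
  obtain ⟨v, hv, hvh, hv'⟩ := h2 u hug
  refine ⟨v, OracleCode.mem_functional_subst hu hv, hvh, fun q hq => ?_⟩
  obtain ⟨s, hs, hsg⟩ := hv' q hq
  obtain ⟨t, ht, htf⟩ := hu' s hsg
  refine ⟨t, OracleCode.mem_functional_subst (hk _ _ _ (hl p q) ?_) ht, htf⟩
  exact OracleCode.mem_functional_subst
    (he _ _ _ (OracleCode.mem_functional_subst (hl p q) hu) (hr p q)) hs

/-- Problems are preordered by Weihrauch reducibility. -/
instance : Preorder Problem where
  le := Reducible
  le_refl := Reducible.refl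
  le_trans _ _ _ := Reducible.trans

end Problem

/-- The Weihrauch degrees: problems up to mutual Weihrauch reducibility, with the partial order
induced by Weihrauch reducibility. -/
abbrev Degree : Type := Antisymmetrization Problem (· ≤ ·)

/-- The Weihrauch degree of a problem. -/
def degree (f : Problem) : Degree := toAntisymmetrization (· ≤ ·) f

/-- The Weihrauch degrees as a first-order structure in the language with the single binary
relation symbol `≤`, interpreted by the order. -/
instance : FirstOrder.Language.order.Structure Degree :=
  FirstOrder.Language.orderStructure Degree

/-- `a` is a strong minimal cover of `b`. -/
def IsStrongMinimalCover {α : Type*} [PartialOrder α] (a b : α) : Prop :=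
  b < a ∧ ∀ c, c < a → c ≤ b

end Weihrauch

/-! A problem lies above `identity` exactly when its domain has a computable point
(`identity_le_iff`). Among the problems below f, those not above `identity` therefore have a
greatest element, f restricted to noncomputable inputs (`le_noncomputableRestrict`). For f =
`identity` this gives the strong minimal cover. If f is not above `identity`, nothing lies strictly
between the restriction of f ⊔ id and f ⊔ id, so the cone above f is not dense.

The other half is `exists_le_not_le`: if f is below neither g nor k, and k is above `identity`, then
some F ≤ f satisfies F ≰ g and f ≰ k ⊔ F. With k = id it shows that a strong minimal cover cannot
fail to be below id; with k = g it gives density above id. F is f with one extra permitted answer, a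
bit G n, for a generic G.

Definability follows, since "greatest strong minimal cover" is first-order. -/

namespace Weihrauch

/-! ### Countability of programs and some program constructions -/

namespace OracleCode

/-- An injective numbering of oracle programs. -/
def encodeNat : OracleCode → ℕ
  | zero => 0
  | succ => 1
  | left => 2
  | right => 3
  | query => 4
  | pair a b => 4 * Nat.pair a.encodeNat b.encodeNat + 5
  | comp a b => 4 * Nat.pair a.encodeNat b.encodeNat + 6
  | prec a b => 4 * Nat.pair a.encodeNat b.encodeNat + 7
  | rfind a => 4 * a.encodeNat + 8

theorem encodeNat_injective : Function.Injective encodeNat := by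
  intro c
  induction c with
  | zero | succ | left | right | query =>
    intro d h
    cases d <;> simp only [encodeNat] at h <;> first | rfl | omega
  | pair a b iha ihb | comp a b iha ihb | prec a b iha ihb =>
    intro d h
    cases d <;> simp only [encodeNat] at h <;> try omega
    obtain ⟨h1, h2⟩ := Nat.pair_eq_pair.1 (Nat.eq_of_mul_eq_mul_left four_pos (by
      simpa using h))
    rw [iha h1, ihb h2]
  | rfind a iha =>
    intro d h
    cases d <;> simp only [encodeNat] at h <;> try omega
    rw [iha (by simpa using h)]

instance : Countable OracleCode :=
  encodeNat_injective.countable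

/-- Programs can be applied pointwise to a computable binary function. -/
theorem exists_map₂ {h : ℕ → ℕ → ℕ} (hh : Computable₂ h) (c d : OracleCode) :
    ∃ e : OracleCode, ∀ x p q, p ∈ c.functional x → q ∈ d.functional x →
      (fun n => h (p n) (q n)) ∈ e.functional x := by
  have hu : Computable fun n : ℕ => h n.unpair.1 n.unpair.2 :=
    hh.comp (Computable.fst.comp Computable.unpair) (Computable.snd.comp Computable.unpair)
  obtain ⟨s, hs⟩ := exists_of_computable hu
  refine ⟨comp s (pair c d), fun x p q hp hq => mem_functional.2 fun n => ?_⟩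
  have hp' := Part.eq_some_iff.2 (mem_functional.1 hp n)
  have hq' := Part.eq_some_iff.2 (mem_functional.1 hq n)
  simp [eval, hp', hq', hs]

/-- A program that returns the value of a computable function at the argument. -/
theorem exists_const {f : ℕ → ℕ} (hf : Computable f) :
    ∃ c : OracleCode, ∀ p, f ∈ c.functional p := by
  obtain ⟨c, hc⟩ := exists_of_computable hf
  exact ⟨c, fun p => mem_functional.2 fun n => by simp [hc]⟩

/-- Definition by cases between two programs, according to a total program: only the selected
program has to halt. -/
theorem exists_branch (t c d : OracleCode) :
    ∃ e : OracleCode, ∀ x z, z ∈ t.functional x → ∀ n,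
      e.eval x n = if z n = 0 then c.eval x n else d.eval x n := by
  have hz : Computable fun n : ℕ => if n = 0 then 1 else 0 :=
    (Primrec.ite (Primrec.eq.comp Primrec.id (Primrec.const 0)) (Primrec.const 1)
      (Primrec.const 0)).to_comp
  have hp : Computable fun n : ℕ => if n = 0 then 0 else 1 :=
    (Primrec.ite (Primrec.eq.comp Primrec.id (Primrec.const 0)) (Primrec.const 0)
      (Primrec.const 1)).to_comp
  have ha : Computable fun n : ℕ => n.unpair.1 + n.unpair.2 :=
    (Primrec.nat_add.comp (Primrec.fst.comp Primrec.unpair)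
      (Primrec.snd.comp Primrec.unpair)).to_comp
  obtain ⟨z₀, hz₀⟩ := exists_of_computable hz
  obtain ⟨z₁, hz₁⟩ := exists_of_computable hp
  obtain ⟨s, hs⟩ := exists_of_computable ha
  obtain ⟨i, hi⟩ := exists_of_computable Computable.id
  -- A recursion with counter 0 or 1 runs its body only for counter 1, so the unselected program is
  -- never started and contributes 0 to the sum.
  refine ⟨comp s (pair (comp (prec zero (comp c left)) (pair i (comp z₀ t)))
    (comp (prec zero (comp d left)) (pair i (comp z₁ t)))), fun x z hz n => ?_⟩
  have hz' := Part.eq_some_iff.2 (mem_functional.1 hz n)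
  by_cases h : z n = 0
  · simp [eval, hz', hz₀, hz₁, hi, h, hs, Part.bind_assoc, Part.bind_some_right]
  · simp [eval, hz', hz₀, hz₁, hi, h, hs]

end OracleCode

/-- The sequence `p` with the number `n` put in front. -/
def cons (n : ℕ) (p : Baire) : Baire
  | 0 => n
  | i + 1 => p i

/-- The sequence `p` without its first entry. -/
def tail (p : Baire) : Baire :=
  fun n => p (n + 1)

/-- The even-indexed entries of `p`, the first component of the pair coded by `p`. -/
def fst (p : Baire) : Baire :=
  fun n => p (2 * n)

@[simp] theorem cons_zero (n : ℕ) (p : Baire) : cons n p 0 = n := rfl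

@[simp] theorem tail_cons (n : ℕ) (p : Baire) : tail (cons n p) = p := rfl

@[simp] theorem fst_join (p q : Baire) : fst (join p q) = p := by
  funext n
  simp [fst, join]

@[simp] theorem join_zero (p q : Baire) : join p q 0 = p 0 := rfl

namespace OracleCode

theorem exists_tail : ∃ c : OracleCode, ∀ p, tail p ∈ c.functional p :=
  exists_reindex Computable.succ

theorem exists_proj_fst : ∃ c : OracleCode, ∀ p, fst p ∈ c.functional p :=
  exists_reindex
    (Primrec.nat_mul.comp (Primrec.const 2) Primrec.id : Primrec fun n : ℕ => 2 * n).to_comp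

theorem exists_cons (m : ℕ) : ∃ c : OracleCode, ∀ p, cons m p ∈ c.functional p := by
  obtain ⟨i, hi⟩ := exists_const Computable.id
  obtain ⟨t, ht⟩ := exists_reindex Primrec.pred.to_comp
  have h : Primrec₂ fun n v : ℕ => if n = 0 then m else v :=
    Primrec.ite (Primrec.eq.comp Primrec.fst (Primrec.const 0)) (Primrec.const m) Primrec.snd
  obtain ⟨c, hc⟩ := exists_map₂ h.to_comp i t
  refine ⟨c, fun p => ?_⟩
  convert hc p _ _ (hi p) (ht p) using 1
  funext n
  cases n <;> simp [cons]

/-- Definition by cases on the first entry of the oracle. -/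
theorem exists_cases (c d : OracleCode) :
    ∃ e : OracleCode, ∀ p r, (p 0 = 0 → r ∈ c.functional p) → (p 0 ≠ 0 → r ∈ d.functional p) →
      r ∈ e.functional p := by
  obtain ⟨t, ht⟩ := exists_reindex (Computable.const 0 : Computable fun _ : ℕ => 0)
  obtain ⟨e, he⟩ := exists_branch t c d
  refine ⟨e, fun p r h0 h1 => mem_functional.2 fun n => ?_⟩
  rw [he p _ (ht p)]
  split_ifs with h
  · exact mem_functional.1 (h0 h) n
  · exact mem_functional.1 (h1 h) n

end OracleCode

/-- A point of Baire space is computable if some program returns it with the zero oracle. -/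
def IsComputablePoint (p : Baire) : Prop :=
  ∃ c : OracleCode, p ∈ c.functional 0

theorem IsComputablePoint.map {p q : Baire} (hp : IsComputablePoint p) {c : OracleCode}
    (hc : q ∈ c.functional p) : IsComputablePoint q := by
  obtain ⟨d, hd⟩ := hp
  exact ⟨c.subst d, OracleCode.mem_functional_subst hd hc⟩

/-! ### Reductions by programs and computable inputs -/

namespace Problem

open OracleCode

/-- The programs `c` and `d` witness that `f` is Weihrauch reducible to `g`. -/
def ReducibleVia (c d : OracleCode) (f g : Problem) : Prop :=
  ∀ p ∈ f.dom, ∃ r ∈ c.functional p, r ∈ g.dom ∧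
    ∀ q ∈ g.sol r, ∃ s ∈ d.functional (join p q), s ∈ f.sol p

theorem le_iff {f g : Problem} : f ≤ g ↔ ∃ c d, ReducibleVia c d f g := by
  constructor
  · rintro ⟨_, _, ⟨c, rfl⟩, ⟨d, rfl⟩, h⟩
    exact ⟨c, d, h⟩
  · rintro ⟨c, d, h⟩
    exact ⟨_, _, ⟨c, rfl⟩, ⟨d, rfl⟩, h⟩

/-- A reduction sends the zero input to a computable point of the domain. Conversely, one such point
serves as query for every input, and the input itself is returned. -/
theorem identity_le_iff {f : Problem} : identity ≤ f ↔ ∃ p ∈ f.dom, IsComputablePoint p := by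
  rw [le_iff]
  constructor
  · rintro ⟨c, d, h⟩
    obtain ⟨r, hr, hf, -⟩ := h 0 ⟨0, rfl⟩
    exact ⟨r, hf, c, hr⟩
  · rintro ⟨p, hp, c, hc⟩
    obtain ⟨l, hl⟩ := exists_fst
    refine ⟨c.subst .zero, l, fun x _ => ⟨p, ?_, hp, fun q _ => ⟨x, hl x q, rfl⟩⟩⟩
    exact mem_functional_subst (mem_functional.2 fun n => Part.mem_some _) hc

/-- The coproduct of two problems: the first entry of the input selects the problem to be
solved. -/
def sum (f g : Problem) : Problem where
  sol p := if p 0 = 0 then f.sol (tail p) else g.sol (tail p)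

theorem le_sum_left (f g : Problem) : f ≤ f.sum g := by
  obtain ⟨c, hc⟩ := exists_cons 0
  obtain ⟨d, hd⟩ := exists_snd
  refine le_iff.2 ⟨c, d, fun p hp => ⟨_, hc p, by simpa [dom, sum] using hp, fun q hq => ?_⟩⟩
  exact ⟨q, hd p q, by simpa [sum] using hq⟩

theorem le_sum_right (f g : Problem) : g ≤ f.sum g := by
  obtain ⟨c, hc⟩ := exists_cons 1
  obtain ⟨d, hd⟩ := exists_snd
  refine le_iff.2 ⟨c, d, fun p hp => ⟨_, hc p, by simpa [dom, sum] using hp, fun q hq => ?_⟩⟩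
  exact ⟨q, hd p q, by simpa [sum] using hq⟩

theorem sum_le {f g k : Problem} (hf : f ≤ k) (hg : g ≤ k) : f.sum g ≤ k := by
  obtain ⟨a, b, hf⟩ := le_iff.1 hf
  obtain ⟨c, d, hg⟩ := le_iff.1 hg
  obtain ⟨t, ht⟩ := exists_tail
  obtain ⟨l, hl⟩ := exists_fst
  obtain ⟨r, hr⟩ := exists_snd
  obtain ⟨j, hj⟩ := exists_join (t.subst l) r
  obtain ⟨e₁, he₁⟩ := exists_cases (a.subst t) (c.subst t)
  obtain ⟨e₂, he₂⟩ := exists_cases (b.subst j) (d.subst j)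
  have hj' : ∀ p q, join (tail p) q ∈ j.functional (join p q) := fun p q =>
    hj _ _ _ (mem_functional_subst (hl p q) (ht p)) (hr p q)
  refine le_iff.2 ⟨e₁, e₂, fun p hp => ?_⟩
  by_cases h : p 0 = 0
  · obtain ⟨u, hu, hk, hs⟩ := hf (tail p) (by simpa [dom, sum, h] using hp)
    refine ⟨u, he₁ p u (fun _ => mem_functional_subst (ht p) hu) (absurd h), hk, fun q hq => ?_⟩
    obtain ⟨s, hs, hsf⟩ := hs q hq
    exact ⟨s, he₂ _ s (fun _ => mem_functional_subst (hj' p q) hs) (absurd h),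
      by simpa [sum, h] using hsf⟩
  · obtain ⟨u, hu, hk, hs⟩ := hg (tail p) (by simpa [dom, sum, h] using hp)
    refine ⟨u, he₁ p u (fun h' => absurd h' h) fun _ => mem_functional_subst (ht p) hu, hk,
      fun q hq => ?_⟩
    obtain ⟨s, hs, hsf⟩ := hs q hq
    exact ⟨s, he₂ _ s (fun h' => absurd h' h) fun _ => mem_functional_subst (hj' p q) hs,
      by simpa [sum, h] using hsf⟩

/-! ### Restriction to noncomputable inputs -/

/-- The problem `f`, to be solved on inputs that are accompanied by a noncomputable point. -/
def noncomputableRestrict (f : Problem) : Problem where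
  sol p := {q | ¬ IsComputablePoint p ∧ q ∈ f.sol (fst p)}

theorem noncomputableRestrict_le (f : Problem) : f.noncomputableRestrict ≤ f := by
  obtain ⟨c, hc⟩ := exists_proj_fst
  obtain ⟨d, hd⟩ := exists_snd
  refine le_iff.2 ⟨c, d, fun p hp => ?_⟩
  obtain ⟨q, hp, hq⟩ := hp
  exact ⟨_, hc p, ⟨q, hq⟩, fun q hq => ⟨q, hd p q, hp, hq⟩⟩

theorem not_identity_le_noncomputableRestrict (f : Problem) :
    ¬ identity ≤ f.noncomputableRestrict := by
  rw [identity_le_iff]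
  rintro ⟨p, ⟨q, hp, -⟩, hc⟩
  exact hp hc

theorem le_noncomputableRestrict {f g : Problem} (h : f ≤ g) (hf : ¬ identity ≤ f) :
    f ≤ g.noncomputableRestrict := by
  rw [identity_le_iff] at hf
  obtain ⟨c, d, h⟩ := le_iff.1 h
  obtain ⟨i, hi⟩ := exists_reindex Computable.id
  obtain ⟨e, he⟩ := exists_join c i
  obtain ⟨r, hr⟩ := exists_snd
  refine le_iff.2 ⟨e, d, fun p hp => ?_⟩
  obtain ⟨u, hu, ⟨v, hv⟩, hs⟩ := h p hp
  -- The input `p` is itself noncomputable because `f` is not above `identity`, so it can accompany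
  -- its own query `u`.
  refine ⟨join u p, he p u p hu (hi p), ⟨v, fun hc => hf ⟨p, hp, hc.map (hr u p)⟩, by simpa⟩, ?_⟩
  rintro q ⟨-, hq⟩
  exact hs q (by simpa using hq)

/-! ### The generic problem below `f` -/

/-- The problem `f` with an input `n` added, and with the constant sequence with value `G n` as an
additional solution. -/
def addConst (f : Problem) (G : ℕ → Bool) : Problem where
  sol p := {q | tail p ∈ f.dom ∧ (q ∈ f.sol (tail p) ∨ q = fun _ => (G (p 0)).toNat)}

theorem mem_dom_addConst {f : Problem} {G : ℕ → Bool} {p : Baire} :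
    p ∈ (f.addConst G).dom ↔ tail p ∈ f.dom :=
  ⟨fun ⟨_, h, _⟩ => h, fun h => ⟨_, h, Or.inr rfl⟩⟩

theorem addConst_le (f : Problem) (G : ℕ → Bool) : f.addConst G ≤ f := by
  obtain ⟨c, hc⟩ := exists_tail
  obtain ⟨d, hd⟩ := exists_snd
  refine le_iff.2 ⟨c, d, fun p hp => ⟨_, hc p, mem_dom_addConst.1 hp, fun q hq => ?_⟩⟩
  exact ⟨q, hd p q, mem_dom_addConst.1 hp, Or.inl hq⟩

/-- If the same programs reduce two problems `f.addConst G` with different values `G n` to `g`,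
then `f` is reducible to `g`. -/
theorem le_of_addConst_reducibleVia {f g : Problem} {c d : OracleCode} {n : ℕ}
    {G : Bool → ℕ → Bool} (hG : ∀ b, G b n = b)
    (h : ∀ b, ReducibleVia c d (f.addConst (G b)) g) : f ≤ g := by
  obtain ⟨a, ha⟩ := exists_cons n
  obtain ⟨l, hl⟩ := exists_fst
  obtain ⟨r, hr⟩ := exists_snd
  obtain ⟨j, hj⟩ := exists_join (a.subst l) r
  refine le_iff.2 ⟨c.subst a, d.subst j, fun p hp => ?_⟩
  obtain ⟨u, hu, hg, h0⟩ := h false (cons n p) (mem_dom_addConst.2 (by simpa))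
  obtain ⟨u', hu', -, h1⟩ := h true (cons n p) (mem_dom_addConst.2 (by simpa))
  obtain rfl := Part.mem_unique hu hu'
  refine ⟨u, mem_functional_subst (ha p) hu, hg, fun q hq => ?_⟩
  obtain ⟨s, hs, -, hs0⟩ := h0 q hq
  obtain ⟨s', hs', -, hs1⟩ := h1 q hq
  obtain rfl := Part.mem_unique hs hs'
  refine ⟨s, mem_functional_subst
    (hj _ _ _ (mem_functional_subst (hl p q) (ha p)) (hr p q)) hs, ?_⟩
  simp only [cons_zero, tail_cons, hG] at hs0 hs1
  -- The output `s` does not depend on `b`; if it did not solve `f`, it would be both constant 0 and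
  -- constant 1.
  rcases hs0 with hs0 | rfl
  · exact hs0
  · rcases hs1 with hs1 | hs1
    · exact hs1
    · simpa using congrFun hs1 0

/-- If a pair of programs reduces `f` to `k.sum (f.addConst G)` for sequences `G` that approximate
a computable sequence, then `f` is reducible to `k.sum identity`. -/
theorem le_sum_identity_of_approx {f k : Problem} {c d : OracleCode} {G : ℕ → Bool}
    (hG : Computable G)
    (h : ∀ m, ∃ G', G' m = G m ∧ ReducibleVia c d f (k.sum (f.addConst G'))) :
    f ≤ k.sum identity := by
  obtain ⟨l, hl⟩ := exists_fst
  obtain ⟨r, hr⟩ := exists_snd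
  -- For a query `u` to the second summand, `identity` answers `q = tail u`, so `q 0 = u 1` is the
  -- index whose bit is a legal answer.
  obtain ⟨e, he⟩ : ∃ e : OracleCode, ∀ u q,
      (if u 0 = 0 then q else fun _ => (G (q 0)).toNat) ∈ e.functional (join u q) := by
    obtain ⟨a, ha⟩ := exists_reindex (Computable.const 0 : Computable fun _ : ℕ => 0)
    obtain ⟨b, hb⟩ := exists_reindex (Computable.const 1 : Computable fun _ : ℕ => 1)
    have hG' : Computable₂ fun _ m : ℕ => (G m).toNat := by
      have : Computable fun b : Bool => b.toNat := (Primrec.dom_finite _).to_comp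
      exact (this.comp hG).comp Computable.snd
    obtain ⟨g, hg⟩ := exists_map₂ hG' b b
    obtain ⟨e, he⟩ := exists_cases r g
    refine ⟨e, fun u q => he _ _ (fun h => ?_) fun h => ?_⟩
    · rw [join_zero] at h
      simpa [h] using hr u q
    · rw [join_zero] at h
      simpa [h, join] using hg _ _ _ (hb (join u q)) (hb (join u q))
  obtain ⟨j₁, hj₁⟩ := exists_join (c.subst l) r
  obtain ⟨j₂, hj₂⟩ := exists_join l (e.subst j₁)
  refine le_iff.2 ⟨c, d.subst j₂, fun p hp => ?_⟩
  have hj : ∀ u q, u ∈ c.functional p →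
      join p (if u 0 = 0 then q else fun _ => (G (q 0)).toNat) ∈ j₂.functional (join p q) :=
    fun u q hu => hj₂ _ _ _ (hl p q) (mem_functional_subst
      (hj₁ _ _ _ (mem_functional_subst (hl p q) hu) (hr p q)) (he u q))
  obtain ⟨_, -, h0⟩ := h 0
  obtain ⟨u, hu, -, -⟩ := h0 p hp
  -- The query `u` is the same for every approximation, so one can be chosen that is correct at `u
  -- 1`.
  obtain ⟨G', hG', h⟩ := h (u 1)
  obtain ⟨u', hu', hk, hs⟩ := h p hp
  obtain rfl := Part.mem_unique hu hu'
  by_cases h0 : u 0 = 0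
  · refine ⟨u, hu, by simpa [dom, sum, h0] using hk, fun q hq => ?_⟩
    obtain ⟨s, hs, hsf⟩ := hs q (by simpa [sum, h0] using hq)
    exact ⟨s, mem_functional_subst (hj u q hu) (by simpa [h0] using hs), hsf⟩
  · refine ⟨u, hu, ⟨tail u, by simp [sum, h0, identity]⟩, fun q hq => ?_⟩
    obtain rfl : q = tail u := by simpa [sum, h0, identity] using hq
    have hd : tail u ∈ (f.addConst G').dom := by simpa [dom, sum, h0] using hk
    obtain ⟨s, hs, hsf⟩ := hs (fun _ => (G (u 1)).toNat) (by
      simp only [sum, h0, if_false]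
      exact ⟨mem_dom_addConst.1 hd, Or.inr (by rw [← hG']; rfl)⟩)
    exact ⟨s, mem_functional_subst (hj u _ hu) (by simpa [h0, tail] using hs), hsf⟩

/-- Countably many requirements on binary sequences, each of which can be forced by extending a
finite initial segment, are met by a common sequence. -/
theorem exists_forall_of_forced {ι : Type*} [Countable ι] (R : ι → (ℕ → Bool) → Prop)
    (h : ∀ i (G : ℕ → Bool) n, ∃ G' : ℕ → Bool, ∃ N, (∀ m < n, G' m = G m) ∧
      ∀ G'', (∀ m < N, G'' m = G' m) → R i G'') :
    ∃ G, ∀ i, R i G := by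
  have hopen : ∀ (G : ℕ → Bool) N, IsOpen {G' : ℕ → Bool | ∀ m < N, G' m = G m} := by
    intro G N
    have : {G' : ℕ → Bool | ∀ m < N, G' m = G m} = ⋂ m ∈ Set.Iio N, {G' | G' m = G m} := by
      ext; simp
    rw [this]
    exact (Set.finite_Iio N).isOpen_biInter fun m _ =>
      (isOpen_discrete ({G m} : Set Bool)).preimage
        (continuous_apply m : Continuous fun G' : ℕ → Bool => G' m)
  -- Baire category theorem in Cantor space.
  have hd : Dense (⋂ i, interior {G | R i G}) := by
    refine dense_iInter_of_isOpen (fun _ => isOpen_interior) fun i => ?_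
    refine dense_iff_inter_open.2 fun U hU ⟨G, hG⟩ => ?_
    obtain ⟨I, u, hu, hIU⟩ := isOpen_pi_iff.1 hU G hG
    obtain ⟨G', N, hG', hR⟩ := h i G (I.sup id + 1)
    refine ⟨G', hIU fun m hm => ?_, ?_⟩
    · rw [hG' m (Nat.lt_succ_of_le (Finset.le_sup (f := id) hm))]
      exact (hu m hm).2
    · exact mem_interior.2 ⟨_, fun G'' => hR G'', hopen G' N, fun _ _ => rfl⟩
  obtain ⟨G, hG⟩ := hd.nonempty
  exact ⟨G, fun i => interior_subset (Set.mem_iInter.1 hG i)⟩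

theorem exists_le_not_le {f g k : Problem} (hk : identity ≤ k) (hg : ¬ f ≤ g) (hfk : ¬ f ≤ k) :
    ∃ F, F ≤ f ∧ ¬ F ≤ g ∧ ¬ f ≤ k.sum F := by
  let R : (OracleCode × OracleCode) ⊕ (OracleCode × OracleCode) → (ℕ → Bool) → Prop :=
    Sum.elim (fun e G => ¬ ReducibleVia e.1 e.2 (f.addConst G) g)
      fun e G => ¬ ReducibleVia e.1 e.2 f (k.sum (f.addConst G))
  obtain ⟨G, hG⟩ := exists_forall_of_forced R (by
    rintro (e | e) G n <;> by_contra! h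
    -- Neither value at `n`, the first free coordinate, rules out the reduction.
    · have h' : ∀ b : Bool, ∃ G' : ℕ → Bool, G' n = b ∧
          ReducibleVia e.1 e.2 (f.addConst G') g := fun b => by
        obtain ⟨G', hG', hR⟩ := h (Function.update G n b) (n + 1)
          fun m hm => Function.update_of_ne hm.ne _ _
        exact ⟨G', by simpa using hG' n n.lt_succ_self, not_not.1 hR⟩
      choose G' hG' hR using h'
      exact hg (le_of_addConst_reducibleVia hG' hR)
    -- The finite condition is continued by `false`, which makes it computable; each of its initial
    -- segments extends to a sequence for which the reduction works.
    · refine hfk (le_trans (le_sum_identity_of_approx (c := e.1) (d := e.2)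
        (G := fun m => if m < n then G m else false) ?_ fun m => ?_) (sum_le le_rfl hk))
      · have : Primrec fun m : ℕ => if m < n then G m else false := by
          refine (Primrec.list_getD false).comp (Primrec.const (List.ofFn fun i : Fin n => G i))
            Primrec.id |>.of_eq fun m => ?_
          by_cases hm : m < n <;> simp [hm]
        exact this.to_comp
      · obtain ⟨G', hG', hR⟩ := h (fun m => if m < n then G m else false) (m + 1)
          fun m hm => by simp [hm]
        exact ⟨G', hG' m m.lt_succ_self, not_not.1 hR⟩)
  refine ⟨f.addConst G, addConst_le f G, fun h => ?_, fun h => ?_⟩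
  · obtain ⟨c, d, h⟩ := le_iff.1 h
    exact hG (Sum.inl (c, d)) h
  · obtain ⟨c, d, h⟩ := le_iff.1 h
    exact hG (Sum.inr (c, d)) h

end Problem

/-! ### Strong minimal covers and dense cones -/

open Problem

theorem degree_le_degree {f g : Problem} : degree f ≤ degree g ↔ f ≤ g := Iff.rfl

theorem exists_degree_eq (a : Degree) : ∃ f, degree f = a := Quotient.exists_rep a

theorem isStrongMinimalCover_identity :
    IsStrongMinimalCover (degree identity) (degree identity.noncomputableRestrict) := by
  refine ⟨lt_of_le_not_ge (noncomputableRestrict_le _)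
    (not_identity_le_noncomputableRestrict _), fun c hc => ?_⟩
  obtain ⟨f, rfl⟩ := exists_degree_eq c
  exact le_noncomputableRestrict (degree_le_degree.1 hc.le) hc.not_ge

theorem IsStrongMinimalCover.le_identity {a b : Degree} (h : IsStrongMinimalCover a b) :
    a ≤ degree identity := by
  obtain ⟨f, rfl⟩ := exists_degree_eq a
  obtain ⟨g, rfl⟩ := exists_degree_eq b
  by_contra hf
  obtain ⟨F, hF, hFg, hfF⟩ := exists_le_not_le (le_refl identity) h.1.not_ge hf
  exact hFg (h.2 (degree F) (lt_of_le_not_ge hF fun h' => hfF (le_trans h' (le_sum_right _ _))))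

theorem isGreatest_identity :
    IsGreatest {a : Degree | ∃ b, IsStrongMinimalCover a b} (degree identity) :=
  ⟨⟨_, isStrongMinimalCover_identity⟩, fun _ ⟨_, h⟩ => h.le_identity⟩

theorem denselyOrdered_Ici_identity : DenselyOrdered (Set.Ici (degree identity)) := by
  refine ⟨fun ⟨b, hb⟩ ⟨c, hc⟩ hbc => ?_⟩
  obtain ⟨g, rfl⟩ := exists_degree_eq b
  obtain ⟨f, rfl⟩ := exists_degree_eq c
  have hgf : degree g < degree f := hbc
  obtain ⟨F, hF, hFg, hfF⟩ := exists_le_not_le hb hgf.not_ge hgf.not_ge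
  have hg : degree g ≤ degree (g.sum F) := le_sum_left g F
  refine ⟨⟨degree (g.sum F), Set.mem_Ici.2 (le_trans (Set.mem_Ici.1 hb) hg)⟩, lt_of_le_not_ge hg fun h => ?_,
    lt_of_le_not_ge (sum_le hgf.le hF : g.sum F ≤ f) hfF⟩
  exact hFg (le_trans (le_sum_right g F) h)

theorem identity_le_of_denselyOrdered_Ici {a : Degree} (h : DenselyOrdered (Set.Ici a)) :
    degree identity ≤ a := by
  obtain ⟨f, rfl⟩ := exists_degree_eq a
  by_contra hf
  have hid : identity ≤ f.sum identity := le_sum_right _ _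
  have hn := not_identity_le_noncomputableRestrict (f.sum identity)
  have hfs : f ≤ f.sum identity := le_sum_left _ _
  obtain ⟨⟨d, hd⟩, h1, h2⟩ := h.dense
    ⟨degree (f.sum identity).noncomputableRestrict, le_noncomputableRestrict hfs hf⟩
    ⟨degree (f.sum identity), hfs⟩
    (lt_of_le_not_ge (noncomputableRestrict_le (f.sum identity)) fun h => hn (le_trans hid h))
  obtain ⟨g, rfl⟩ := exists_degree_eq d
  by_cases hg : identity ≤ g
  -- An intermediate `g` above `identity` is above the whole join; otherwise it is below the
  -- restriction.
  · exact h2.not_ge (sum_le hd hg : f.sum identity ≤ g)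
  · exact h1.not_ge (le_noncomputableRestrict h2.le hg : g ≤ _)

theorem isLeast_identity :
    IsLeast {a : Degree | DenselyOrdered (Set.Ici a)} (degree identity) :=
  ⟨denselyOrdered_Ici_identity, fun _ => identity_le_of_denselyOrdered_Ici⟩

end Weihrauch

/-! ### First-order definability -/

namespace FirstOrder.Language

/-- The formula in the language of orders that says of a variable that it is a strong minimal
cover. -/
def strongMinimalCoverFormula {α : Type*} {n : ℕ} (x : α ⊕ Fin n) :
    Language.order.BoundedFormula α n :=
  let u : Language.order.Term (α ⊕ Fin (n + 1)) := Term.var (x.map id Fin.castSucc)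
  let v : Language.order.Term (α ⊕ Fin (n + 2)) :=
    Term.var (x.map id (Fin.castSucc ∘ Fin.castSucc))
  let y : Language.order.Term (α ⊕ Fin (n + 1)) := Term.var (Sum.inr (Fin.last n))
  let y' : Language.order.Term (α ⊕ Fin (n + 2)) := Term.var (Sum.inr (Fin.last n).castSucc)
  let z : Language.order.Term (α ⊕ Fin (n + 2)) := Term.var (Sum.inr (Fin.last (n + 1)))
  (y.lt u ⊓ (z.lt v ⟹ z.le y').all).ex

theorem realize_strongMinimalCoverFormula {M α : Type*} [PartialOrder M]
    [Language.order.Structure M] [Language.order.OrderedStructure M] {n : ℕ} (x : α ⊕ Fin n)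
    (v : α → M) (w : Fin n → M) :
    (strongMinimalCoverFormula x).Realize v w ↔
      ∃ b, Weihrauch.IsStrongMinimalCover (Sum.elim v w x) b := by
  cases x <;> simp [strongMinimalCoverFormula, Weihrauch.IsStrongMinimalCover, Fin.snoc]

end FirstOrder.Language

open FirstOrder Language in
/-- The greatest strong minimal cover of a partial order is definable without parameters. -/
theorem definable₁_of_isGreatest_isStrongMinimalCover {M : Type*} [PartialOrder M]
    [Language.order.Structure M] [Language.order.OrderedStructure M] {a : M}
    (ha : IsGreatest {a : M | ∃ b, Weihrauch.IsStrongMinimalCover a b} a) :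
    (∅ : Set M).Definable₁ Language.order {a} := by
  refine Set.empty_definable_iff.2 ⟨strongMinimalCoverFormula (Sum.inl 0) ⊓
    (strongMinimalCoverFormula (Sum.inr 0) ⟹
      (Term.var (Sum.inr 0)).le (Term.var (Sum.inl 0))).all, ?_⟩
  ext x
  -- Greatest elements are unique, so the formula has no other solution.
  have h : x 0 = a ↔ IsGreatest {a : M | ∃ b, Weihrauch.IsStrongMinimalCover a b} (x 0) :=
    ⟨fun h => h ▸ ha, fun h => h.unique ha⟩
  simp [h, Formula.Realize, realize_strongMinimalCoverFormula, IsGreatest, upperBounds, Fin.snoc]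

theorem mainTheorem5 :
    (∅ : Set Weihrauch.Degree).Definable₁ FirstOrder.Language.order
        {Weihrauch.degree Weihrauch.Problem.identity} ∧
      IsGreatest {a : Weihrauch.Degree | ∃ b, Weihrauch.IsStrongMinimalCover a b}
        (Weihrauch.degree Weihrauch.Problem.identity) ∧
      IsLeast {a : Weihrauch.Degree | DenselyOrdered (Set.Ici a)}
        (Weihrauch.degree Weihrauch.Problem.identity) := by
  refine ⟨?_, Weihrauch.isGreatest_identity, Weihrauch.isLeast_identity⟩
  have : FirstOrder.Language.order.OrderedStructure Weihrauch.Degree := ⟨fun _ => Iff.rfl⟩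
  exact definable₁_of_isGreatest_isStrongMinimalCover Weihrauch.isGreatest_identity
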